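/- Let $a\ge 0$ and let $r,p,q:[a,\infty)\to\mathbb R$ be continuous with $r>0$ and $p>0$ on $[a,\infty)$. Consider the equation $$(r(x)y'')''-(q(x)y')'=p(x)y,\qquad x\in[a,\infty), \tag{E}$$ and put $y_1=ry''$ and $Ty=(ry'')'-qy'$. A solution of (E) is a function $y$ on $[a,\infty)$ such that $y$, $y'$, $y_1$ and $Ty$ are differentiable and $(Ty)'=py$ on $[a,\infty)$ (one-sided derivatives at $a$). The first systems-conjugate point $\hat\eta_1(a)$ is the smallest $b\in(a,\infty)$ for which some nontrivial solution of (E) satisfies $y(a)=y_1(a)=y(b)=y_1(b)=0$. The first systems-focal point $\hat\mu_1(a)$ is the smallest $b\in(a,\infty)$ for which some nontrivial solution of (E) satisfies $y(a)=y_1(a)=y'(b)=Ty(b)=0$. Each is said to exist if such a smallest number exists. Consider the condition $$\int_a^b\left[r\,(w')^2+q\,w^2\right]dx>0\quad\text{for each } b>a \text{ and each nontrivial } w\in W_2^1[a,b], \tag{P}$$ where $W_2^1[a,b]$ is the Sobolev space of functions in $L_2[a,b]$ having a generalized first derivative $w'$ in $L_2[a,b]$. 1. If $\hat\eta_1(a)$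 exists and (P) holds, then $\hat\mu_1(a)$ exists and $a<\hat\mu_1(a)<\hat\eta_1(a)$. 2. If $\hat\mu_1(a)$ exists and $\int_a^{\infty}q=-\infty$, that is, $\lim_{x\to\infty}\int_a^x q(t)\,dt=-\infty$, then $\hat\eta_1(a)$ exists. If in addition (P) holds, then $a<\hat\mu_1(a)<\hat\eta_1(a)$. -/

import Mathlib

open Set Filter MeasureTheory Topology
open scoped ContDiff

namespace SystemsConjugate

/-- The derivative of `y` regarded as a function on `[a, ∞)` (one-sided at `a`). -/
noncomputable def D (a : ℝ) (y : ℝ → ℝ) : ℝ → ℝ := derivWithin y (Ici a)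

/-- The quasi-derivative `y₁ = r y''` on `[a, ∞)`. -/
noncomputable def quasi (a : ℝ) (r y : ℝ → ℝ) : ℝ → ℝ :=
  fun x => r x * D a (D a y) x

/-- The quasi-derivative `T y = (r y'')' - q y'` on `[a, ∞)`. -/
noncomputable def T (a : ℝ) (r q y : ℝ → ℝ) : ℝ → ℝ :=
  fun x => D a (quasi a r y) x - q x * D a y x

/-- `y` is a solution on `[a, ∞)` of `(r y'')'' - (q y')' = p y`. The coefficients being merely
continuous, the equation is read, as usual, through quasi-derivatives:
`y`, `y'`, `r y''` and `T y = (r y'')' - q y'` are differentiable and `(T y)' = p y`. -/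
structure IsSolution (a : ℝ) (r p q y : ℝ → ℝ) : Prop where
  diff_y : DifferentiableOn ℝ y (Ici a)
  diff_y' : DifferentiableOn ℝ (D a y) (Ici a)
  diff_quasi : DifferentiableOn ℝ (quasi a r y) (Ici a)
  diff_T : DifferentiableOn ℝ (T a r q y) (Ici a)
  eq : ∀ x ∈ Ici a, D a (T a r q y) x = p x * y x

/-- `y` is not identically zero on `[a, ∞)`. -/
def NotIdenticallyZero (a : ℝ) (y : ℝ → ℝ) : Prop := ∃ x ∈ Ici a, y x ≠ 0

/-- The points `b > a` for which some nontrivial solution satisfies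
`y(a) = y₁(a) = y(b) = y₁(b) = 0`. -/
def conjugatePoints (a : ℝ) (r p q : ℝ → ℝ) : Set ℝ :=
  {b | a < b ∧ ∃ y : ℝ → ℝ, IsSolution a r p q y ∧ NotIdenticallyZero a y ∧
    y a = 0 ∧ quasi a r y a = 0 ∧ y b = 0 ∧ quasi a r y b = 0}

/-- The points `b > a` for which some nontrivial solution satisfies
`y(a) = y₁(a) = y'(b) = T y(b) = 0`. -/
def focalPoints (a : ℝ) (r p q : ℝ → ℝ) : Set ℝ :=
  {b | a < b ∧ ∃ y : ℝ → ℝ, IsSolution a r p q y ∧ NotIdenticallyZero a y ∧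
    y a = 0 ∧ quasi a r y a = 0 ∧ D a y b = 0 ∧ T a r q y b = 0}

/-- The first systems-conjugate point of `a` exists and equals `η`. -/
def IsSystemsConjugatePoint (a : ℝ) (r p q : ℝ → ℝ) (η : ℝ) : Prop :=
  IsLeast (conjugatePoints a r p q) η

/-- The first systems-focal point of `a` exists and equals `μ`. -/
def IsSystemsFocalPoint (a : ℝ) (r p q : ℝ → ℝ) (μ : ℝ) : Prop :=
  IsLeast (focalPoints a r p q) μ

/-- `w` belongs to the Sobolev space `W₂¹[a, b]` and `g` is (a representative of) its generalized
derivative: both are in `L₂[a, b]`, and `∫ w φ' = - ∫ g φ` for all smooth `φ` with compact support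
in `(a, b)`. -/
structure IsSobolev (a b : ℝ) (w g : ℝ → ℝ) : Prop where
  memLp_w : MemLp w 2 (volume.restrict (Icc a b))
  memLp_g : MemLp g 2 (volume.restrict (Icc a b))
  weak_deriv : ∀ φ : ℝ → ℝ, ContDiff ℝ ∞ φ → HasCompactSupport φ → tsupport φ ⊆ Ioo a b →
    ∫ x in a..b, w x * deriv φ x = - ∫ x in a..b, g x * φ x

/-- `∫_a^b [r (w')² + q w²] > 0` for each `b > a` and each `w ∈ W₂¹[a, b]` that is not zero as an
element of that space, i.e. not almost everywhere zero. -/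
def FormPositive (a : ℝ) (r q : ℝ → ℝ) : Prop :=
  ∀ b : ℝ, a < b → ∀ w g : ℝ → ℝ, IsSobolev a b w g →
    ¬ (w =ᵐ[volume.restrict (Icc a b)] 0) →
    0 < ∫ x in a..b, (r x * g x ^ 2 + q x * w x ^ 2)

end SystemsConjugate

/-! Solutions with `y(a) = y₁(a) = 0` form a plane with basis `Y`, `Z`. Conjugate and focal points
are the zeros in `(a, ∞)` of the minors `m02` and `m13` of this basis (`boundaryPoints_eq`).
Self-adjointness gives `m03 = m12`, so these minors satisfy the closed system `IsMinorSystem`.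

Part 1 (`IsMinorSystem.m02_pos`): condition (P), tested on the solution of `(rφ')' = qφ` with `φ(a)
= 1`, `(rφ')(a) = 0`, gives `φ > 0` and `rφ' ≥ 0`. While `m13 > 0`, integrating gives `m12 > 0`, and
comparison with `φ` then gives `m01 > 0` and `m02 > 0`. Hence `m02` cannot vanish at `η` unless
`m13` vanishes strictly before.

Part 2 (`IsMinorSystem.exists_m02_eq_zero`): if `m02` had no zero, `m01` would be positive and
increasing. By a Riccati identity `-m13/m01` is increasing, so past `μ` the minor `m13` stays below
a negative constant and `m12` is eventually nonpositive. Then `(m02/m01)' ≤ q`, which forces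
`m02/m01 → -∞`, a contradiction. The strict inequality comes from part 1. -/

namespace SystemsConjugate

/-! ### Linear differential equations: existence and uniqueness. -/

section LinearODE

variable {E : Type*} [NormedAddCommGroup E] [NormedSpace ℝ E]

/-- The terms of the Picard series of the linear equation `Y' = A Y`, `Y a = x₀`. -/
noncomputable def picardTerm (A : ℝ → E →L[ℝ] E) (a : ℝ) (x₀ : E) : ℕ → ℝ → E
  | 0 => fun _ => x₀
  | n + 1 => fun t => ∫ s in a..t, A s (picardTerm A a x₀ n s)

lemma continuous_picardTerm [CompleteSpace E] {A : ℝ → E →L[ℝ] E} (hA : Continuous A) (a : ℝ)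
    (x₀ : E) (n : ℕ) : Continuous (picardTerm A a x₀ n) := by
  induction n with
  | zero => exact continuous_const
  | succ n ih =>
    have h : Continuous fun s => A s (picardTerm A a x₀ n s) := hA.clm_apply ih
    exact intervalIntegral.continuous_primitive (fun _ _ => h.intervalIntegrable _ _) a

lemma hasDerivAt_picardTerm_succ [CompleteSpace E] {A : ℝ → E →L[ℝ] E} (hA : Continuous A)
    (a : ℝ) (x₀ : E) (n : ℕ) (t : ℝ) :
    HasDerivAt (picardTerm A a x₀ (n + 1)) (A t (picardTerm A a x₀ n t)) t :=
  ((hA.clm_apply (continuous_picardTerm hA a x₀ n)).integral_hasStrictDerivAt a t).hasDerivAt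

lemma norm_picardTerm_le [CompleteSpace E] {A : ℝ → E →L[ℝ] E} {a R M : ℝ}
    (hM : ∀ t, |t - a| ≤ R → ‖A t‖ ≤ M) (x₀ : E) (n : ℕ) :
    ∀ t, |t - a| ≤ R → ‖picardTerm A a x₀ n t‖ ≤ ‖x₀‖ * ((M * |t - a|) ^ n / n.factorial) := by
  induction n with
  | zero => intro t _; simp [picardTerm]
  | succ n ih =>
    intro t ht
    have hM0 : 0 ≤ M := (norm_nonneg _).trans (hM t ht)
    calc ‖picardTerm A a x₀ (n + 1) t‖
        ≤ ∫ s in uIoc a t, M * ‖x₀‖ * M ^ n / n.factorial * |s - a| ^ n := by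
          rw [picardTerm, intervalIntegral.norm_intervalIntegral_eq]
          apply norm_integral_le_of_norm_le (Continuous.integrableOn_uIoc (by fun_prop))
          refine (ae_restrict_mem measurableSet_uIoc).mono fun s hs => ?_
          have hs' : |s - a| ≤ R := by
            rcases le_total a t with h | h
            · rw [uIoc_of_le h] at hs
              rw [abs_of_nonneg (by linarith)] at ht
              rw [abs_of_nonneg (by linarith [hs.1])]; linarith [hs.2]
            · rw [uIoc_of_ge h] at hs
              rw [abs_of_nonpos (by linarith)] at ht
              rw [abs_of_nonpos (by linarith [hs.2])]; linarith [hs.1]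
          calc ‖A s (picardTerm A a x₀ n s)‖ ≤ ‖A s‖ * ‖picardTerm A a x₀ n s‖ :=
                (A s).le_opNorm _
            _ ≤ M * (‖x₀‖ * ((M * |s - a|) ^ n / n.factorial)) :=
                mul_le_mul (hM s hs') (ih s hs') (norm_nonneg _) hM0
            _ = _ := by rw [mul_pow]; ring
      _ = M * ‖x₀‖ * M ^ n / n.factorial * (|t - a| ^ (n + 1) / (n + 1)) := by
          rw [integral_const_mul, integral_pow_abs_sub_uIoc]
      _ = ‖x₀‖ * ((M * |t - a|) ^ (n + 1) / (n + 1).factorial) := by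
          rw [Nat.factorial_succ, mul_pow]; push_cast
          field_simp
          ring

/-- Global existence for linear differential equations with continuous coefficients. -/
theorem exists_linearODE_solution [CompleteSpace E] {A : ℝ → E →L[ℝ] E} (hA : Continuous A)
    (a : ℝ) (x₀ : E) : ∃ Y : ℝ → E, Y a = x₀ ∧ ∀ t, HasDerivAt Y (A t (Y t)) t := by
  have bound : ∀ R : ℝ, ∃ M, 0 ≤ M ∧ ∀ t, |t - a| ≤ R → ‖A t‖ ≤ M := by
    intro R
    obtain ⟨M, hM⟩ := (isCompact_Icc (a := a - R) (b := a + R)).exists_bound_of_continuousOn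
      hA.continuousOn
    refine ⟨max M 0, le_max_right _ _, fun t ht => le_max_of_le_left (hM t ?_)⟩
    rw [abs_le] at ht
    exact ⟨by linarith [ht.1], by linarith [ht.2]⟩
  have hsum : ∀ t, Summable fun n => picardTerm A a x₀ n t := by
    intro t
    obtain ⟨M, -, hM⟩ := bound |t - a|
    exact Summable.of_norm_bounded ((Real.summable_pow_div_factorial (M * |t - a|)).mul_left ‖x₀‖)
      fun n => norm_picardTerm_le hM x₀ n t le_rfl
  refine ⟨fun t => ∑' n, picardTerm A a x₀ n t, ?_, fun t => ?_⟩
  · beta_reduce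
    rw [tsum_eq_single 0]
    · rfl
    · intro n hn
      obtain ⟨m, rfl⟩ := Nat.exists_eq_succ_of_ne_zero hn
      simp [picardTerm]
  · obtain ⟨M, hM0, hM⟩ := bound (|t - a| + 1)
    have hR : 0 ≤ |t - a| + 1 := by positivity
    -- The constant term is split off because every later term has derivative `A` applied to its
    -- predecessor. The radius exceeds `|t - a|` by one so that the open ball contains `t`.
    have key := hasDerivAt_tsum_of_isPreconnected
      (g := fun n => picardTerm A a x₀ (n + 1)) (g' := fun n s => A s (picardTerm A a x₀ n s))
      (u := fun n => M * (‖x₀‖ * ((M * (|t - a| + 1)) ^ n / n.factorial)))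
      (t := Metric.ball a (|t - a| + 1)) (y₀ := a) (y := t)
      (((Real.summable_pow_div_factorial _).mul_left ‖x₀‖).mul_left M) Metric.isOpen_ball
      (convex_ball a _).isPreconnected
      (fun n s _ => hasDerivAt_picardTerm_succ hA a x₀ n s)
      (fun n s hs => by
        have hs' : |s - a| ≤ |t - a| + 1 := (Metric.mem_ball.1 hs).le
        refine ((A s).le_opNorm _).trans
          (mul_le_mul (hM s hs') ((norm_picardTerm_le hM x₀ n s hs').trans ?_)
            (norm_nonneg _) hM0)
        gcongr)
      (Metric.mem_ball_self (by positivity)) ((summable_nat_add_iff 1).2 (hsum a))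
      (by rw [Metric.mem_ball, Real.dist_eq]; linarith)
    have h1 : (fun s => ∑' n, picardTerm A a x₀ n s) =
        fun s => x₀ + ∑' n, picardTerm A a x₀ (n + 1) s := by
      funext s
      exact (hsum s).tsum_eq_zero_add
    rw [h1, ← h1, (A t).map_tsum (hsum t)]
    rw [h1]
    exact key.const_add x₀

/-- Uniqueness for linear differential equations on a half-line. -/
theorem linearODE_eq_zero {A : ℝ → E →L[ℝ] E} (hA : Continuous A) {a : ℝ} {Y : ℝ → E}
    (hY : ∀ t ∈ Ici a, HasDerivWithinAt Y (A t (Y t)) (Ici a) t) (h0 : Y a = 0) :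
    ∀ t ∈ Ici a, Y t = 0 := by
  intro t ht
  obtain ⟨M, hM⟩ := (isCompact_Icc (a := a) (b := t)).exists_bound_of_continuousOn
    hA.continuousOn
  refine eq_zero_of_abs_deriv_le_mul_abs_self_of_eq_zero_right (K := M) (a := a) (b := t)
    (fun s hs => ((hY s hs.1).continuousWithinAt).mono Icc_subset_Ici_self)
    (fun s hs => (hY s hs.1).mono (Ici_subset_Ici.2 hs.1)) h0 (fun s hs => ?_) t ⟨ht, le_rfl⟩
  exact ((A s).le_opNorm _).trans
    (mul_le_mul_of_nonneg_right (hM s ⟨hs.1, hs.2.le⟩) (norm_nonneg _))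

end LinearODE

/-! ### Sign analysis of the minors. -/

section Minors

lemma lt_of_hasDerivAt_pos {f f' : ℝ → ℝ} {c d : ℝ} (hcd : c < d)
    (hf : ∀ t ∈ Icc c d, HasDerivAt f (f' t) t) (hpos : ∀ t ∈ Ioo c d, 0 < f' t) : f c < f d := by
  refine strictMonoOn_of_deriv_pos (convex_Icc c d)
    (fun t ht => (hf t ht).continuousAt.continuousWithinAt) (fun t ht => ?_)
    (left_mem_Icc.2 hcd.le) (right_mem_Icc.2 hcd.le) hcd
  rw [interior_Icc] at ht
  rw [(hf t (Ioo_subset_Icc_self ht)).deriv]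
  exact hpos t ht

lemma le_of_hasDerivAt_nonpos {f f' : ℝ → ℝ} {c d : ℝ} (hcd : c ≤ d)
    (hf : ∀ t ∈ Icc c d, HasDerivAt f (f' t) t) (hneg : ∀ t ∈ Ioo c d, f' t ≤ 0) : f d ≤ f c := by
  refine antitoneOn_of_deriv_nonpos (convex_Icc c d)
    (fun t ht => (hf t ht).continuousAt.continuousWithinAt)
    (fun t ht => ((hf t (interior_subset ht)).differentiableAt).differentiableWithinAt)
    (fun t ht => ?_) (left_mem_Icc.2 hcd) (right_mem_Icc.2 hcd) hcd
  rw [interior_Icc] at ht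
  rw [(hf t (Ioo_subset_Icc_self ht)).deriv]
  exact hneg t ht

/-- A continuous function that does not vanish just to the right of `a` has a first zero in
`(a, ∞)` if it has any zero there. -/
lemma exists_isLeast_zero {f : ℝ → ℝ} {a τ b : ℝ} (hf : ContinuousOn f (Ici a)) (hτ : a < τ)
    (hne : ∀ t ∈ Ioc a τ, f t ≠ 0) (hab : a < b) (hb : f b = 0) :
    ∃ m, IsLeast {t | a < t ∧ f t = 0} m := by
  -- `f` may vanish at `a` itself; the gap up to `τ` is what makes the zero set closed.
  have hset : {t | a < t ∧ f t = 0} = Ici τ ∩ f ⁻¹' {0} := by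
    ext t
    constructor
    · rintro ⟨h1, h2⟩
      exact ⟨le_of_not_gt fun h => hne t ⟨h1, h.le⟩ h2, h2⟩
    · rintro ⟨h1, h2⟩
      exact ⟨hτ.trans_le h1, h2⟩
  have hcl : IsClosed {t | a < t ∧ f t = 0} := by
    rw [hset]
    exact (hf.mono (Ici_subset_Ici.2 hτ.le)).preimage_isClosed_of_isClosed isClosed_Ici
      isClosed_singleton
  exact ⟨_, hcl.isLeast_csInf ⟨b, hab, hb⟩ ⟨a, fun t ht => ht.1.le⟩⟩

/-- The differential system satisfied by the `2 × 2` minors of two solutions `y`, `z` with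
`y(a) = y₁(a) = z(a) = z₁(a) = 0`, normalised by `y'(a) = T z(a) = 1`, `T y(a) = z'(a) = 0`:
`m01 = y z' - z y'`, `m02 = y z₁ - z y₁`, `m12 = y' z₁ - z' y₁ = y T z - z T y`,
`m13 = y' T z - z' T y` and `m23 = y₁ T z - z₁ T y`. -/
structure IsMinorSystem (a : ℝ) (r p q m01 m02 m12 m13 m23 : ℝ → ℝ) : Prop where
  d01 : ∀ t ∈ Ici a, HasDerivAt m01 (m02 t / r t) t
  d02 : ∀ t ∈ Ici a, HasDerivAt m02 (2 * m12 t + q t * m01 t) t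
  d12 : ∀ t ∈ Ici a, HasDerivAt m12 (m13 t) t
  d13 : ∀ t ∈ Ici a, HasDerivAt m13 (m23 t / r t - p t * m01 t) t
  i01 : m01 a = 0
  i02 : m02 a = 0
  i12 : m12 a = 0
  i13 : m13 a = 1
  pluecker : ∀ t ∈ Ici a, m02 t * m13 t = m01 t * m23 t + m12 t ^ 2

variable {a : ℝ} {r p q m01 m02 m12 m13 m23 : ℝ → ℝ}

/-- If `m13` is positive on `(a, b)` and `(r φ')' = q φ` has a solution with `φ > 0`, `r φ' ≥ 0` on
`[a, b]`, then `m02` is positive at `b`. -/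
lemma IsMinorSystem.m02_pos (h : IsMinorSystem a r p q m01 m02 m12 m13 m23)
    (hr : ∀ x ∈ Ici a, 0 < r x) {φ ζ : ℝ → ℝ} {b : ℝ} (hab : a < b)
    (hφ : ∀ t ∈ Icc a b, HasDerivAt φ (ζ t / r t) t)
    (hζ : ∀ t ∈ Icc a b, HasDerivAt ζ (q t * φ t) t)
    (hφ0 : ∀ t ∈ Icc a b, 0 < φ t) (hζ0 : ∀ t ∈ Icc a b, 0 ≤ ζ t)
    (hm : ∀ t ∈ Ioo a b, 0 < m13 t) : 0 < m02 b := by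
  have h12 : ∀ t ∈ Ioc a b, 0 < m12 t := by
    intro t ht
    rw [← h.i12]
    exact lt_of_hasDerivAt_pos ht.1 (fun s hs => h.d12 s hs.1)
      fun s hs => hm s ⟨hs.1, hs.2.trans_le ht.2⟩
  -- This is the Wronskian of `φ` and `m01`; the `q` terms cancel in its derivative, leaving `2 φ
  -- m12`.
  have hG : ∀ t ∈ Ioc a b, 0 < φ t * m02 t - ζ t * m01 t := by
    intro t ht
    have := lt_of_hasDerivAt_pos (f := fun t => φ t * m02 t - ζ t * m01 t)
      (f' := fun t => 2 * φ t * m12 t) ht.1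
      (fun s hs => by
        have hs' : s ∈ Icc a b := ⟨hs.1, hs.2.trans ht.2⟩
        have hr' := (hr s hs.1).ne'
        refine (((hφ s hs').mul (h.d02 s hs.1)).sub ((hζ s hs').mul (h.d01 s hs.1))).congr_deriv ?_
        field_simp
        ring)
      (fun s hs => by
        have h1 := hφ0 s ⟨hs.1.le, hs.2.le.trans ht.2⟩
        have h2 := h12 s ⟨hs.1, hs.2.le.trans ht.2⟩
        positivity)
    simpa [h.i01, h.i02] using this
  have hΔ : 0 < m01 b / φ b := by
    have := lt_of_hasDerivAt_pos (f := fun t => m01 t / φ t)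
      (f' := fun t => (φ t * m02 t - ζ t * m01 t) / (r t * φ t ^ 2)) hab
      (fun s hs => by
        have hr' := (hr s hs.1).ne'
        have hφ' := (hφ0 s hs).ne'
        refine ((h.d01 s hs.1).div (hφ s hs) hφ').congr_deriv ?_
        field_simp)
      (fun s hs => by
        have h1 := hφ0 s ⟨hs.1.le, hs.2.le⟩
        have h2 := hG s ⟨hs.1, hs.2.le⟩
        have h3 := hr s hs.1.le
        positivity)
    simpa [h.i01] using this
  have hbφ := hφ0 b ⟨hab.le, le_rfl⟩
  have hbΔ : 0 < m01 b := by
    rw [div_pos_iff_of_pos_right hbφ] at hΔ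
    exact hΔ
  have h1 := hG b ⟨hab, le_rfl⟩
  have h2 := mul_nonneg (hζ0 b ⟨hab.le, le_rfl⟩) hbΔ.le
  exact pos_of_mul_pos_right (by linarith : 0 < φ b * m02 b) hbφ.le

lemma IsMinorSystem.exists_m13_pos (h : IsMinorSystem a r p q m01 m02 m12 m13 m23) :
    ∃ τ, a < τ ∧ ∀ t ∈ Icc a τ, 0 < m13 t := by
  have h1 : ∀ᶠ t in 𝓝 a, 0 < m13 t :=
    (h.d13 a self_mem_Ici).continuousAt.eventually (lt_mem_nhds (by simp [h.i13]))
  obtain ⟨ε, hε, hball⟩ := Metric.eventually_nhds_iff.1 h1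
  refine ⟨a + ε / 2, by linarith, fun t ht => hball ?_⟩
  rw [Real.dist_eq, abs_lt]
  constructor <;> linarith [ht.1, ht.2]

/-- Near `a` the comparison function needs no form condition: strictly positive initial values stay
positive by continuity. -/
lemma IsMinorSystem.exists_m02_pos (h : IsMinorSystem a r p q m01 m02 m12 m13 m23)
    (hr : ∀ x ∈ Ici a, 0 < r x) {φ ζ : ℝ → ℝ}
    (hφ : ∀ t ∈ Ici a, HasDerivAt φ (ζ t / r t) t)
    (hζ : ∀ t ∈ Ici a, HasDerivAt ζ (q t * φ t) t) (hφ0 : 0 < φ a) (hζ0 : 0 < ζ a) :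
    ∃ τ, a < τ ∧ ∀ t ∈ Ioc a τ, 0 < m02 t := by
  obtain ⟨τ, hτ, hm⟩ := h.exists_m13_pos
  have h1 : ∀ᶠ t in 𝓝 a, 0 < φ t ∧ 0 < ζ t :=
    ((hφ a self_mem_Ici).continuousAt.eventually (lt_mem_nhds hφ0)).and
      ((hζ a self_mem_Ici).continuousAt.eventually (lt_mem_nhds hζ0))
  obtain ⟨ε, hε, hball⟩ := Metric.eventually_nhds_iff.1 h1
  have hpos : ∀ t ∈ Icc a (a + ε / 2), 0 < φ t ∧ 0 < ζ t := fun t ht => hball (by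
    rw [Real.dist_eq, abs_lt]
    constructor <;> linarith [ht.1, ht.2])
  refine ⟨min τ (a + ε / 2), lt_min hτ (by linarith), fun t ht => ?_⟩
  have hsub : ∀ s ∈ Icc a t, s ∈ Icc a (a + ε / 2) := fun s hs =>
    ⟨hs.1, (hs.2.trans ht.2).trans (min_le_right _ _)⟩
  exact h.m02_pos hr ht.1 (fun s hs => hφ s hs.1) (fun s hs => hζ s hs.1)
    (fun s hs => (hpos s (hsub s hs)).1) (fun s hs => (hpos s (hsub s hs)).2.le)
    (fun s hs => hm s ⟨hs.1.le, (hs.2.le.trans ht.2).trans (min_le_left _ _)⟩)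

/-- If `∫ q = -∞` and `m13` has a zero in `(a, ∞)`, then so has `m02`. -/
lemma IsMinorSystem.exists_m02_eq_zero (h : IsMinorSystem a r p q m01 m02 m12 m13 m23)
    (hr : ∀ x ∈ Ici a, 0 < r x) (hp : ∀ x ∈ Ici a, 0 < p x) (hq : Continuous q) {τ : ℝ}
    (hτ : a < τ) (hτ0 : 0 < m02 τ) {μ : ℝ} (hμ : a < μ) (hμ0 : m13 μ = 0)
    (hlim : Tendsto (fun x => ∫ t in a..x, q t) atTop atBot) :
    ∃ b, a < b ∧ m02 b = 0 := by
  by_contra! hne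
  have hC : ∀ t, a < t → 0 < m02 t := by
    intro t ht
    by_contra! hle
    obtain ⟨s, hs, hs0⟩ := isPreconnected_Ioi.intermediate_value (mem_Ioi.2 ht) (mem_Ioi.2 hτ)
      (fun s (hs : a < s) => (h.d02 s hs.le).continuousAt.continuousWithinAt) ⟨hle, hτ0.le⟩
    exact hne s hs hs0
  have hΔ : ∀ t, a < t → 0 < m01 t := by
    intro t ht
    rw [← h.i01]
    exact lt_of_hasDerivAt_pos ht (fun s hs => h.d01 s hs.1)
      fun s hs => div_pos (hC s hs.1) (hr s hs.1.le)
  have hΔmono : ∀ c t, a < c → c ≤ t → m01 c ≤ m01 t := by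
    intro c t hc hct
    rcases hct.eq_or_lt with rfl | hct
    · exact le_rfl
    · exact (lt_of_hasDerivAt_pos hct (fun s hs => h.d01 s (hc.le.trans hs.1))
        fun s hs => div_pos (hC s (hc.trans hs.1)) (hr s (hc.trans hs.1).le)).le
  -- The Plücker relation turns the `m23` and `m02 m13` terms into the square `m12²`.
  have hd : ∀ t, a < t → HasDerivAt (fun t => -(m13 t / m01 t))
      (p t + m12 t ^ 2 / (r t * m01 t ^ 2)) t := by
    intro t ht
    have hr' := (hr t ht.le).ne'
    have hΔ' := (hΔ t ht).ne'
    refine ((h.d13 t ht.le).div (h.d01 t ht.le) hΔ').neg.congr_deriv ?_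
    have hpl := h.pluecker t ht.le
    field_simp
    linear_combination hpl
  have hdpos : ∀ t, a < t → 0 < p t + m12 t ^ 2 / (r t * m01 t ^ 2) := by
    intro t ht
    have h1 := hr t ht.le
    have h2 := hp t ht.le
    have h3 := hΔ t ht
    positivity
  have hdlt : ∀ c t, a < c → c < t → -(m13 c / m01 c) < -(m13 t / m01 t) := fun c t hc hct =>
    lt_of_hasDerivAt_pos (f := fun t => -(m13 t / m01 t)) hct
      (fun s hs => hd s (hc.trans_le hs.1)) fun s hs => hdpos s (hc.trans hs.1)
  -- `κ` is `-m13 (μ + 1)`, positive since the increasing quotient `-m13/m01` vanishes at `μ`. It is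
  -- written as quotient times `m01` because both factors can only grow.
  obtain ⟨κ, hκ, hD⟩ : ∃ κ > 0, ∀ t, μ + 1 ≤ t → m13 t ≤ -κ := by
    have h1 : a < μ + 1 := by linarith
    have h0 := hdlt μ (μ + 1) hμ (by linarith)
    rw [hμ0, zero_div, neg_zero] at h0
    refine ⟨-(m13 (μ + 1) / m01 (μ + 1)) * m01 (μ + 1), mul_pos h0 (hΔ _ h1), fun t ht => ?_⟩
    have h2 : -(m13 (μ + 1) / m01 (μ + 1)) ≤ -(m13 t / m01 t) := by
      rcases ht.eq_or_lt with rfl | ht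
      · exact le_rfl
      · exact (hdlt _ _ h1 ht).le
    have h3 := mul_le_mul h2 (hΔmono _ t h1 ht) (hΔ _ h1).le (h0.le.trans h2)
    have h4 : -(m13 t / m01 t) * m01 t = - m13 t := by
      have := (hΔ t (h1.trans_le ht)).ne'
      field_simp
    linarith
  -- `m12` falls at rate at least `κ`, so a time `|m12 (μ + 1)| / κ` uses up its initial value.
  obtain ⟨t₂, ht₂, hE⟩ : ∃ t₂, μ + 1 ≤ t₂ ∧ ∀ t, t₂ ≤ t → m12 t ≤ 0 := by
    refine ⟨μ + 1 + |m12 (μ + 1)| / κ, by have : 0 ≤ |m12 (μ + 1)| / κ := by positivity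
                                          linarith, fun t ht => ?_⟩
    have h1 : μ + 1 ≤ t := le_trans (by have : 0 ≤ |m12 (μ + 1)| / κ := by positivity
                                        linarith) ht
    have h2 := le_of_hasDerivAt_nonpos (f := fun t => m12 t + κ * t) (f' := fun t => m13 t + κ) h1
      (fun s hs => ((h.d12 s ((hμ.trans (lt_add_one μ)).le.trans hs.1)).add
        ((hasDerivAt_id s).const_mul κ)).congr_deriv (by simp))
      (fun s hs => by linarith [hD s hs.1.le])
    have h3 : |m12 (μ + 1)| ≤ κ * (t - (μ + 1)) := by
      rw [← div_le_iff₀' hκ]; linarith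
    have h4 := le_abs_self (m12 (μ + 1))
    linarith
  have hat₂ : a < t₂ := by linarith
  -- Subtracting the integral cancels `q`; both remaining terms of the derivative are nonpositive.
  have hs : ∀ t, t₂ ≤ t → m02 t / m01 t - (∫ x in a..t, q x) ≤
      m02 t₂ / m01 t₂ - ∫ x in a..t₂, q x := by
    intro t ht
    refine le_of_hasDerivAt_nonpos (f := fun t => m02 t / m01 t - ∫ x in a..t, q x)
      (f' := fun t => 2 * (m12 t / m01 t) - m02 t ^ 2 / (r t * m01 t ^ 2)) ht (fun s hs => ?_)
      (fun s hs => ?_)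
    · have has : a < s := hat₂.trans_le hs.1
      have hr' := (hr s has.le).ne'
      have hΔ' := (hΔ s has).ne'
      refine (((h.d02 s has.le).div (h.d01 s has.le) hΔ').sub
        (hq.integral_hasStrictDerivAt a s).hasDerivAt).congr_deriv ?_
      field_simp
      ring
    · have has : a < s := hat₂.trans hs.1
      have h1 := hr s has.le
      have h2 := hΔ s has
      have h3 : m12 s / m01 s ≤ 0 := div_nonpos_of_nonpos_of_nonneg (hE s hs.1.le) h2.le
      have h4 : 0 ≤ m02 s ^ 2 / (r s * m01 s ^ 2) := by positivity
      linarith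
  obtain ⟨t, ht, htq⟩ := ((eventually_ge_atTop t₂).and (hlim.eventually
    (eventually_lt_atBot ((∫ x in a..t₂, q x) - m02 t₂ / m01 t₂)))).exists
  have h1 := hs t ht
  have hat := hat₂.trans_le ht
  have h2 := div_pos (hC t hat) (hΔ t hat)
  linarith

end Minors

/-! ### From the fourth-order equation to first-order systems and minors. -/

section Transfer

open Matrix

/-- Multiplication of vectors by a matrix, as a continuous linear map. -/
noncomputable def mulVecCLM {n : ℕ} (M : Matrix (Fin n) (Fin n) ℝ) :
    (Fin n → ℝ) →L[ℝ] (Fin n → ℝ) :=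
  LinearMap.toContinuousLinearMap (Matrix.toLin' M)

lemma mulVecCLM_apply {n : ℕ} (M : Matrix (Fin n) (Fin n) ℝ) (x : Fin n → ℝ) :
    mulVecCLM M x = M *ᵥ x := by
  simp [mulVecCLM]

lemma continuous_mulVecCLM {n : ℕ} :
    Continuous (mulVecCLM : Matrix (Fin n) (Fin n) ℝ → (Fin n → ℝ) →L[ℝ] (Fin n → ℝ)) := by
  exact LinearMap.continuous_of_finiteDimensional
    ((Matrix.toLin' (R := ℝ) (m := Fin n) (n := Fin n)).trans
      LinearMap.toContinuousLinearMap).toLinearMap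

lemma exists_matrixODE_solution {n : ℕ} {M : ℝ → Matrix (Fin n) (Fin n) ℝ} (hM : Continuous M)
    (a : ℝ) (x₀ : Fin n → ℝ) :
    ∃ Y : ℝ → Fin n → ℝ, Y a = x₀ ∧ ∀ t, HasDerivAt Y (M t *ᵥ Y t) t := by
  obtain ⟨Y, h0, hY⟩ := exists_linearODE_solution (continuous_mulVecCLM.comp hM) a x₀
  exact ⟨Y, h0, fun t => by simpa [mulVecCLM_apply] using hY t⟩

lemma matrixODE_eq_zero {n : ℕ} {M : ℝ → Matrix (Fin n) (Fin n) ℝ} (hM : Continuous M) {a : ℝ}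
    {Y : ℝ → Fin n → ℝ} (hY : ∀ t ∈ Ici a, HasDerivWithinAt Y (M t *ᵥ Y t) (Ici a) t)
    (h0 : Y a = 0) : ∀ t ∈ Ici a, Y t = 0 :=
  linearODE_eq_zero (continuous_mulVecCLM.comp hM)
    (fun t ht => by simpa [mulVecCLM_apply] using hY t ht) h0

/-- The coefficient matrix of the first-order system for `(y, y', y₁, T y)`. -/
noncomputable def coeffMatrix (r p q : ℝ → ℝ) (t : ℝ) : Matrix (Fin 4) (Fin 4) ℝ :=
  !![0, 1, 0, 0; 0, 0, (r t)⁻¹, 0; 0, q t, 0, 1; p t, 0, 0, 0]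

lemma continuous_coeffMatrix {r p q : ℝ → ℝ} (hr : Continuous r) (hp : Continuous p)
    (hq : Continuous q) (hr0 : ∀ t, 0 < r t) : Continuous (coeffMatrix r p q) := by
  have hri : Continuous fun t => (r t)⁻¹ := hr.inv₀ fun t => (hr0 t).ne'
  refine continuous_matrix fun i j => ?_
  fin_cases i <;> fin_cases j <;> simp [coeffMatrix] <;> first | assumption | fun_prop

lemma coeffMatrix_mulVec (r p q : ℝ → ℝ) (t : ℝ) (x : Fin 4 → ℝ) :
    coeffMatrix r p q t *ᵥ x = ![x 1, x 2 / r t, q t * x 1 + x 3, p t * x 0] := by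
  funext i
  fin_cases i <;> simp [coeffMatrix, Matrix.mulVec, dotProduct, Fin.sum_univ_four] <;> ring

/-- The vector of quasi-derivatives `(y, y', y₁, T y)`. -/
noncomputable def jet (a : ℝ) (r q y : ℝ → ℝ) (t : ℝ) : Fin 4 → ℝ :=
  ![y t, D a y t, quasi a r y t, T a r q y t]

lemma hasDerivWithinAt_D {a : ℝ} {y : ℝ → ℝ} (hy : DifferentiableOn ℝ y (Ici a)) {t : ℝ}
    (ht : t ∈ Ici a) : HasDerivWithinAt y (D a y t) (Ici a) t :=
  (hy t ht).hasDerivWithinAt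

lemma D_eq {a : ℝ} {y : ℝ → ℝ} {c t : ℝ} (ht : t ∈ Ici a)
    (h : HasDerivWithinAt y c (Ici a) t) : D a y t = c :=
  h.derivWithin (uniqueDiffOn_Ici a t ht)

lemma D_congr {a : ℝ} {y z : ℝ → ℝ} (h : EqOn y z (Ici a)) : EqOn (D a y) (D a z) (Ici a) :=
  fun _ ht => derivWithin_congr h (h ht)

lemma IsSolution.hasDerivWithinAt_jet {a : ℝ} {r p q u : ℝ → ℝ} (h : IsSolution a r p q u)
    (hr : ∀ x ∈ Ici a, 0 < r x) {t : ℝ} (ht : t ∈ Ici a) :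
    HasDerivWithinAt (jet a r q u) (coeffMatrix r p q t *ᵥ jet a r q u t) (Ici a) t := by
  rw [hasDerivWithinAt_pi, coeffMatrix_mulVec]
  intro i
  have hr' := (hr t ht).ne'
  fin_cases i
  · exact hasDerivWithinAt_D h.diff_y ht
  · refine (hasDerivWithinAt_D h.diff_y' ht).congr_deriv ?_
    simp [jet, quasi, hr']
  · refine (hasDerivWithinAt_D h.diff_quasi ht).congr_deriv ?_
    simp [jet, T]
  · exact (hasDerivWithinAt_D h.diff_T ht).congr_deriv (h.eq t ht)

lemma isSolution_of_hasDerivWithinAt {a : ℝ} {r p q : ℝ → ℝ} (hr : ∀ x ∈ Ici a, 0 < r x)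
    {Y : ℝ → Fin 4 → ℝ}
    (hY : ∀ t ∈ Ici a, HasDerivWithinAt Y (coeffMatrix r p q t *ᵥ Y t) (Ici a) t) :
    IsSolution a r p q (fun t => Y t 0) ∧
      ∀ t ∈ Ici a, jet a r q (fun t => Y t 0) t = Y t := by
  have hc : ∀ t ∈ Ici a, ∀ i, HasDerivWithinAt (fun s => Y s i)
      (![Y t 1, Y t 2 / r t, q t * Y t 1 + Y t 3, p t * Y t 0] i) (Ici a) t := by
    intro t ht
    rw [← hasDerivWithinAt_pi, ← coeffMatrix_mulVec]
    exact hY t ht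
  have h0 : ∀ t ∈ Ici a, HasDerivWithinAt (fun s => Y s 0) (Y t 1) (Ici a) t :=
    fun t ht => hc t ht 0
  have h1 : ∀ t ∈ Ici a, HasDerivWithinAt (fun s => Y s 1) (Y t 2 / r t) (Ici a) t :=
    fun t ht => hc t ht 1
  have h2 : ∀ t ∈ Ici a, HasDerivWithinAt (fun s => Y s 2) (q t * Y t 1 + Y t 3) (Ici a) t :=
    fun t ht => hc t ht 2
  have h3 : ∀ t ∈ Ici a, HasDerivWithinAt (fun s => Y s 3) (p t * Y t 0) (Ici a) t :=
    fun t ht => hc t ht 3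
  have e1 : EqOn (D a fun s => Y s 0) (fun s => Y s 1) (Ici a) := fun t ht => D_eq ht (h0 t ht)
  have e2 : EqOn (quasi a r fun s => Y s 0) (fun s => Y s 2) (Ici a) := by
    intro t ht
    have := (hr t ht).ne'
    rw [quasi, D_congr e1 ht, D_eq ht (h1 t ht)]
    field_simp
  have e3 : EqOn (T a r q fun s => Y s 0) (fun s => Y s 3) (Ici a) := by
    intro t ht
    simp only [T]
    rw [D_congr e2 ht, D_eq ht (h2 t ht), e1 ht]
    ring
  refine ⟨⟨fun t ht => (h0 t ht).differentiableWithinAt,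
    fun t ht => ((h1 t ht).congr e1 (e1 ht)).differentiableWithinAt,
    fun t ht => ((h2 t ht).congr e2 (e2 ht)).differentiableWithinAt,
    fun t ht => ((h3 t ht).congr e3 (e3 ht)).differentiableWithinAt,
    fun t ht => by rw [D_congr e3 ht, D_eq ht (h3 t ht)]⟩, fun t ht => ?_⟩
  funext i
  fin_cases i
  · rfl
  · exact e1 ht
  · exact e2 ht
  · exact e3 ht

/-- A nonzero row, rotated by a right angle, is a kernel vector. -/
lemma exists_ne_zero_of_det_eq_zero {x₁ y₁ x₂ y₂ : ℝ} (h : x₁ * y₂ - y₁ * x₂ = 0) :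
    ∃ α β : ℝ, (α ≠ 0 ∨ β ≠ 0) ∧ α * x₁ + β * y₁ = 0 ∧ α * x₂ + β * y₂ = 0 := by
  by_cases h1 : x₁ = 0 ∧ y₁ = 0
  · by_cases h2 : x₂ = 0 ∧ y₂ = 0
    · exact ⟨1, 0, by simp, by simp [h1], by simp [h2]⟩
    · refine ⟨-y₂, x₂, by grind, by simp [h1], by ring⟩
  · exact ⟨-y₁, x₁, by grind, by ring, by linarith⟩

/-- Points `b > a` where a nontrivial solution with `y(a) = y₁(a) = 0` has two vanishing
quasi-derivatives are the zeros of a `2 × 2` minor of a basis of such solutions. -/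
lemma boundaryPoints_eq {a : ℝ} {r p q R P Q : ℝ → ℝ} (hr : ∀ x ∈ Ici a, 0 < r x)
    (hM : Continuous (coeffMatrix R P Q))
    (hMeq : EqOn (coeffMatrix R P Q) (coeffMatrix r p q) (Ici a)) {Y Z : ℝ → Fin 4 → ℝ}
    (hY : ∀ t, HasDerivAt Y (coeffMatrix R P Q t *ᵥ Y t) t)
    (hZ : ∀ t, HasDerivAt Z (coeffMatrix R P Q t *ᵥ Z t) t)
    (hYa : Y a = ![0, 1, 0, 0]) (hZa : Z a = ![0, 0, 0, 1]) (i j : Fin 4) :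
    {b | a < b ∧ ∃ y : ℝ → ℝ, IsSolution a r p q y ∧ NotIdenticallyZero a y ∧
      y a = 0 ∧ quasi a r y a = 0 ∧ jet a r q y b i = 0 ∧ jet a r q y b j = 0} =
    {b | a < b ∧ Y b i * Z b j - Z b i * Y b j = 0} := by
  have hcomb : ∀ α β : ℝ, ∀ t, HasDerivAt (fun s => α • Y s + β • Z s)
      (coeffMatrix R P Q t *ᵥ (α • Y t + β • Z t)) t := by
    intro α β t
    refine (((hY t).const_smul α).add ((hZ t).const_smul β)).congr_deriv ?_
    rw [mulVec_add, mulVec_smul, mulVec_smul]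
  ext b
  refine and_congr_right fun hab => ⟨?_, fun hb => ?_⟩
  · rintro ⟨u, hu, ⟨x, hx, hux⟩, hua, hqa, hi, hj⟩
    -- Both sides solve the same linear system and agree at `a`.
    have hrep : ∀ t ∈ Ici a, jet a r q u t =
        D a u a • Y t + T a r q u a • Z t := by
      intro t ht
      have h0 := matrixODE_eq_zero hM
        (Y := fun s => jet a r q u s - (D a u a • Y s + T a r q u a • Z s)) (a := a)
        (fun s hs => by
          refine ((hu.hasDerivWithinAt_jet hr hs).sub
            (hcomb _ _ s).hasDerivWithinAt).congr_deriv ?_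
          rw [mulVec_sub, hMeq hs])
        (by
          funext k
          simp only [hYa, hZa, jet, hua, hqa]
          fin_cases k <;> simp) t ht
      exact sub_eq_zero.1 h0
    rw [hrep b hab.le] at hi hj
    simp only [Pi.add_apply, Pi.smul_apply, smul_eq_mul] at hi hj
    by_contra hne
    have hα : D a u a = 0 := by
      have : D a u a * (Y b i * Z b j - Z b i * Y b j) = 0 := by
        linear_combination Z b j * hi - Z b i * hj
      exact (mul_eq_zero.1 this).resolve_right hne
    have hβ : T a r q u a = 0 := by
      have : T a r q u a * (Y b i * Z b j - Z b i * Y b j) = 0 := by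
        linear_combination Y b i * hj - Y b j * hi
      exact (mul_eq_zero.1 this).resolve_right hne
    have := congrFun (hrep x hx) 0
    rw [hα, hβ] at this
    exact hux (by simpa [jet] using this)
  · obtain ⟨α, β, hne, hi, hj⟩ := exists_ne_zero_of_det_eq_zero hb
    obtain ⟨hsol, hjet⟩ := isSolution_of_hasDerivWithinAt hr (p := p) (q := q)
      (Y := fun s => α • Y s + β • Z s)
      fun t ht => by rw [← hMeq ht]; exact (hcomb α β t).hasDerivWithinAt
    have hja := hjet a self_mem_Ici
    refine ⟨_, hsol, ?_, ?_, ?_, ?_, ?_⟩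
    -- A solution vanishing on `[a, ∞)` has zero jet at `a`, but entries 1 and 3 of that jet are `α`
    -- and `β`.
    · by_contra hzero
      have hz : ∀ x ∈ Ici a, (α • Y x + β • Z x) 0 = 0 := by
        simpa [NotIdenticallyZero] using hzero
      set u : ℝ → ℝ := fun s => (α • Y s + β • Z s) 0 with hu
      have e0 : EqOn u (fun _ => 0) (Ici a) := hz
      have hD0 : ∀ t, D a (fun _ => (0 : ℝ)) t = 0 := fun t => by simp [D]
      have e1 : EqOn (D a u) (fun _ => 0) (Ici a) := fun t ht => by rw [D_congr e0 ht, hD0]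
      have e2 : EqOn (quasi a r u) (fun _ => 0) (Ici a) := fun t ht => by
        rw [quasi, D_congr e1 ht, hD0, mul_zero]
      have e3 : T a r q u a = 0 := by
        rw [T, D_congr e2 self_mem_Ici, hD0, e1 self_mem_Ici]; simp
      have hα : α = 0 := by
        have h1 := congrFun hja 1
        have h2 : jet a r q u a 1 = 0 := e1 self_mem_Ici
        rw [h2] at h1
        simpa [hYa, hZa] using h1.symm
      have hβ : β = 0 := by
        have h1 := congrFun hja 3
        have h2 : jet a r q u a 3 = 0 := e3
        rw [h2] at h1
        simpa [hYa, hZa] using h1.symm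
      exact hne.elim (· hα) (· hβ)
    · simp [hYa, hZa]
    · have h1 := congrFun hja 2
      simpa [hYa, hZa, jet] using h1
    · rw [hjet b hab.le]; simpa using hi
    · rw [hjet b hab.le]; simpa using hj

lemma conjugatePoints_eq_jet (a : ℝ) (r p q : ℝ → ℝ) : conjugatePoints a r p q =
    {b | a < b ∧ ∃ y : ℝ → ℝ, IsSolution a r p q y ∧ NotIdenticallyZero a y ∧
      y a = 0 ∧ quasi a r y a = 0 ∧ jet a r q y b 0 = 0 ∧ jet a r q y b 2 = 0} := rfl

lemma focalPoints_eq_jet (a : ℝ) (r p q : ℝ → ℝ) : focalPoints a r p q =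
    {b | a < b ∧ ∃ y : ℝ → ℝ, IsSolution a r p q y ∧ NotIdenticallyZero a y ∧
      y a = 0 ∧ quasi a r y a = 0 ∧ jet a r q y b 1 = 0 ∧ jet a r q y b 3 = 0} := rfl

/-- The minors of the basis of solutions with `y(a) = y₁(a) = 0` form a minor system. -/
lemma isMinorSystem_of_hasDerivAt {a : ℝ} {r p q : ℝ → ℝ} {Y Z : ℝ → Fin 4 → ℝ}
    (hY : ∀ t, HasDerivAt Y (coeffMatrix r p q t *ᵥ Y t) t)
    (hZ : ∀ t, HasDerivAt Z (coeffMatrix r p q t *ᵥ Z t) t)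
    (hYa : Y a = ![0, 1, 0, 0]) (hZa : Z a = ![0, 0, 0, 1]) :
    IsMinorSystem a r p q (fun t => Y t 0 * Z t 1 - Z t 0 * Y t 1)
      (fun t => Y t 0 * Z t 2 - Z t 0 * Y t 2) (fun t => Y t 1 * Z t 2 - Z t 1 * Y t 2)
      (fun t => Y t 1 * Z t 3 - Z t 1 * Y t 3) (fun t => Y t 2 * Z t 3 - Z t 2 * Y t 3) := by
  have comp : ∀ {X : ℝ → Fin 4 → ℝ}, (∀ t, HasDerivAt X (coeffMatrix r p q t *ᵥ X t) t) →
      (∀ t, HasDerivAt (fun s => X s 0) (X t 1) t) ∧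
      (∀ t, HasDerivAt (fun s => X s 1) (X t 2 / r t) t) ∧
      (∀ t, HasDerivAt (fun s => X s 2) (q t * X t 1 + X t 3) t) ∧
      (∀ t, HasDerivAt (fun s => X s 3) (p t * X t 0) t) := by
    intro X hX
    simp only [coeffMatrix_mulVec, hasDerivAt_pi] at hX
    exact ⟨fun t => hX t 0, fun t => hX t 1, fun t => hX t 2, fun t => hX t 3⟩
  obtain ⟨y0, y1, y2, y3⟩ := comp hY
  obtain ⟨z0, z1, z2, z3⟩ := comp hZ
  -- Lagrange's identity: the difference has zero derivative and vanishes at `a`.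
  have hiso : ∀ t, Y t 0 * Z t 3 - Z t 0 * Y t 3 = Y t 1 * Z t 2 - Z t 1 * Y t 2 := by
    intro t
    have hd : ∀ s, HasDerivAt (fun s => (Y s 0 * Z s 3 - Z s 0 * Y s 3) -
        (Y s 1 * Z s 2 - Z s 1 * Y s 2)) 0 s := fun s =>
      ((((y0 s).mul (z3 s)).sub ((z0 s).mul (y3 s))).sub
        (((y1 s).mul (z2 s)).sub ((z1 s).mul (y2 s)))).congr_deriv (by ring)
    have hconst := is_const_of_deriv_eq_zero (fun s => (hd s).differentiableAt)
      (fun s => (hd s).deriv) t a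
    simp only [hYa, hZa] at hconst
    simp at hconst
    linarith
  refine ⟨fun t _ => ?_, fun t _ => ?_, fun t _ => ?_, fun t _ => ?_, ?_, ?_, ?_, ?_,
    fun t _ => ?_⟩
  · exact (((y0 t).mul (z1 t)).sub ((z0 t).mul (y1 t))).congr_deriv (by ring)
  · refine (((y0 t).mul (z2 t)).sub ((z0 t).mul (y2 t))).congr_deriv ?_
    linear_combination hiso t
  · exact (((y1 t).mul (z2 t)).sub ((z1 t).mul (y2 t))).congr_deriv (by ring)
  · exact (((y1 t).mul (z3 t)).sub ((z1 t).mul (y3 t))).congr_deriv (by ring)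
  · simp [hYa, hZa]
  · simp [hYa, hZa]
  · simp [hYa, hZa]
  · simp [hYa, hZa]
  · rw [sq]
    -- Only one factor of `m12²` becomes `m03`, which leaves the Plücker relation in its general
    -- form.
    nth_rewrite 1 [← hiso t]
    ring

/-! ### The comparison function and condition (P). -/

/-- Solutions of the second-order system `φ' = ζ / r`, `ζ' = q φ`. -/
lemma exists_sturmLiouville_solution {r q : ℝ → ℝ} (hr : Continuous r) (hq : Continuous q)
    (hr0 : ∀ t, 0 < r t) (a c d : ℝ) : ∃ φ ζ : ℝ → ℝ, φ a = c ∧ ζ a = d ∧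
      (∀ t, HasDerivAt φ (ζ t / r t) t) ∧ ∀ t, HasDerivAt ζ (q t * φ t) t := by
  have hri : Continuous fun t => (r t)⁻¹ := hr.inv₀ fun t => (hr0 t).ne'
  obtain ⟨Y, hYa, hY⟩ := exists_matrixODE_solution (n := 2)
    (M := fun t => !![0, (r t)⁻¹; q t, 0])
    (continuous_matrix fun i j => by
      fin_cases i <;> fin_cases j <;> simp <;> first | assumption | fun_prop) a ![c, d]
  simp only [hasDerivAt_pi] at hY
  refine ⟨fun t => Y t 0, fun t => Y t 1, by simp [hYa], by simp [hYa],
    fun t => (hY t 0).congr_deriv ?_, fun t => (hY t 1).congr_deriv ?_⟩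
  · simp [Matrix.mulVec, dotProduct, Fin.sum_univ_two]; ring
  · simp [Matrix.mulVec, dotProduct, Fin.sum_univ_two]

lemma isSobolev_of_hasDerivAt (a b : ℝ) {w g : ℝ → ℝ}
    (hw : ∀ t, HasDerivAt w (g t) t) (hg : Continuous g) : IsSobolev a b w g := by
  have hwc : Continuous w := continuous_iff_continuousAt.2 fun t => (hw t).continuousAt
  have hmem : ∀ f : ℝ → ℝ, Continuous f → MemLp f 2 (volume.restrict (Icc a b)) := by
    intro f hf
    obtain ⟨C, hC⟩ := (isCompact_Icc (a := a) (b := b)).exists_bound_of_continuousOn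
      hf.continuousOn
    exact MemLp.of_bound hf.aestronglyMeasurable C
      ((ae_restrict_mem measurableSet_Icc).mono hC)
  refine ⟨hmem w hwc, hmem g hg, fun φ hφ _ hsupp => ?_⟩
  have hφ0 : ∀ x, x ∉ Ioo a b → φ x = 0 := fun x hx =>
    image_eq_zero_of_notMem_tsupport fun h => hx (hsupp h)
  have hφd : ∀ t, HasDerivAt φ (deriv φ t) t := fun t =>
    ((hφ.differentiable (by simp)) t).hasDerivAt
  have hφc : Continuous (deriv φ) := hφ.continuous_deriv (by simp)
  rw [intervalIntegral.integral_mul_deriv_eq_deriv_mul (fun t _ => hw t) (fun t _ => hφd t)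
    (hg.intervalIntegrable _ _) (hφc.intervalIntegrable _ _), hφ0 a (by simp), hφ0 b (by simp)]
  simp

lemma FormPositive.mul_pos {a : ℝ} {r q R Q φ ζ : ℝ → ℝ} (h : FormPositive a r q)
    (hR : Continuous R) (hQ : Continuous Q) (hR0 : ∀ t, 0 < R t) (hRr : EqOn R r (Ici a))
    (hQq : EqOn Q q (Ici a)) (hφ : ∀ t, HasDerivAt φ (ζ t / R t) t)
    (hζ : ∀ t, HasDerivAt ζ (Q t * φ t) t) (hφa : φ a = 1) (hζa : ζ a = 0) {b : ℝ}
    (hab : a < b) : 0 < φ b * ζ b := by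
  have hφc : Continuous φ := continuous_iff_continuousAt.2 fun t => (hφ t).continuousAt
  have hζc : Continuous ζ := continuous_iff_continuousAt.2 fun t => (hζ t).continuousAt
  have hgc : Continuous fun t => ζ t / R t := hζc.div hR fun t => (hR0 t).ne'
  have key := h b hab φ _ (isSobolev_of_hasDerivAt a b hφ hgc) fun hzero => by
    have := Measure.eqOn_Icc_of_ae_eq (μ := volume) hab.ne hzero hφc.continuousOn
      continuousOn_const (left_mem_Icc.2 hab.le)
    simp [hφa] at this
  -- The integrand is the derivative of `φ ζ`.
  have hint : ∫ x in a..b, (r x * (ζ x / R x) ^ 2 + q x * φ x ^ 2) =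
      φ b * ζ b - φ a * ζ a := by
    rw [← intervalIntegral.integral_eq_sub_of_hasDerivAt (f := fun x => φ x * ζ x)
      (fun t _ => (hφ t).mul (hζ t)) (by
        apply Continuous.intervalIntegrable
        fun_prop)]
    refine intervalIntegral.integral_congr fun x hx => ?_
    rw [uIcc_of_le hab.le] at hx
    have := (hR0 x).ne'
    simp only [← hRr hx.1, ← hQq hx.1]
    field_simp
  rw [hint, hζa, mul_zero, sub_zero] at key
  exact key

/-- Since `φ ζ > 0` beyond `a`, `φ` cannot vanish, so it keeps the sign of `φ a = 1`, and `ζ`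
inherits it. -/
lemma FormPositive.pos_and_nonneg {a : ℝ} {r q R Q φ ζ : ℝ → ℝ} (h : FormPositive a r q)
    (hR : Continuous R) (hQ : Continuous Q) (hR0 : ∀ t, 0 < R t) (hRr : EqOn R r (Ici a))
    (hQq : EqOn Q q (Ici a)) (hφ : ∀ t, HasDerivAt φ (ζ t / R t) t)
    (hζ : ∀ t, HasDerivAt ζ (Q t * φ t) t) (hφa : φ a = 1) (hζa : ζ a = 0) {t : ℝ}
    (ht : a ≤ t) : 0 < φ t ∧ 0 ≤ ζ t := by
  have hφc : Continuous φ := continuous_iff_continuousAt.2 fun t => (hφ t).continuousAt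
  have hprod : ∀ b, a < b → 0 < φ b * ζ b := fun b hab =>
    h.mul_pos hR hQ hR0 hRr hQq hφ hζ hφa hζa hab
  have hφ0 : 0 < φ t := by
    by_contra! hle
    obtain ⟨s, hs, hs0⟩ := intermediate_value_Icc' ht hφc.continuousOn
      (show (0 : ℝ) ∈ Icc (φ t) (φ a) from ⟨hle, by simp [hφa]⟩)
    rcases hs.1.eq_or_lt with rfl | has
    · simp [hφa] at hs0
    · simpa [hs0] using hprod s has
  refine ⟨hφ0, ?_⟩
  rcases ht.eq_or_lt with rfl | hat
  · rw [hζa]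
  · exact (pos_of_mul_pos_right (hprod t hat) hφ0.le).le

/-- Constant extension to the left of `a` lets the systems be solved on all of `ℝ`, with two-sided
derivatives at `a`; positivity survives because no new values appear. -/
lemma exists_continuous_eqOn_Ici {a : ℝ} {f : ℝ → ℝ} (hf : ContinuousOn f (Ici a)) :
    ∃ g : ℝ → ℝ, Continuous g ∧ EqOn g f (Ici a) ∧ ∀ t, ∃ s ∈ Ici a, g t = f s :=
  ⟨fun t => f (max a t), hf.comp_continuous (by fun_prop) fun t => le_max_left a t,
    fun t ht => by simp only [max_eq_right (mem_Ici.1 ht)],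
    fun t => ⟨max a t, le_max_left a t, rfl⟩⟩

end Transfer

end SystemsConjugate

/-! ### The main theorem. -/

open SystemsConjugate in
theorem mainTheorem1 (a : ℝ) (ha : 0 ≤ a) (r p q : ℝ → ℝ)
    (hr : ContinuousOn r (Set.Ici a)) (hp : ContinuousOn p (Set.Ici a))
    (hq : ContinuousOn q (Set.Ici a))
    (hr_pos : ∀ x ∈ Set.Ici a, 0 < r x) (hp_pos : ∀ x ∈ Set.Ici a, 0 < p x) :
    ((∀ η : ℝ, SystemsConjugate.IsSystemsConjugatePoint a r p q η →
        SystemsConjugate.FormPositive a r q →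
        ∃ μ : ℝ, SystemsConjugate.IsSystemsFocalPoint a r p q μ ∧ a < μ ∧ μ < η) ∧
      (∀ μ : ℝ, SystemsConjugate.IsSystemsFocalPoint a r p q μ →
        Filter.Tendsto (fun x : ℝ => ∫ t in a..x, q t) Filter.atTop Filter.atBot →
        ∃ η : ℝ, SystemsConjugate.IsSystemsConjugatePoint a r p q η ∧
          (SystemsConjugate.FormPositive a r q → a < μ ∧ μ < η))) := by
  obtain ⟨R, hR, hRr, hRm⟩ := exists_continuous_eqOn_Ici hr
  obtain ⟨P, hP, hPp, hPm⟩ := exists_continuous_eqOn_Ici hp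
  obtain ⟨Q, hQ, hQq, -⟩ := exists_continuous_eqOn_Ici hq
  have hR0 : ∀ t, 0 < R t := fun t => by
    obtain ⟨s, hs, h⟩ := hRm t
    rw [h]
    exact hr_pos s hs
  have hP0 : ∀ t, 0 < P t := fun t => by
    obtain ⟨s, hs, h⟩ := hPm t
    rw [h]
    exact hp_pos s hs
  have hM := continuous_coeffMatrix hR hP hQ hR0
  have hMeq : EqOn (coeffMatrix R P Q) (coeffMatrix r p q) (Ici a) := fun t ht => by
    simp only [coeffMatrix, hRr ht, hPp ht, hQq ht]
  obtain ⟨Y, hYa, hY⟩ := exists_matrixODE_solution hM a ![0, 1, 0, 0]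
  obtain ⟨Z, hZa, hZ⟩ := exists_matrixODE_solution hM a ![0, 0, 0, 1]
  have hminor := isMinorSystem_of_hasDerivAt hY hZ hYa hZa
  have hconj := (conjugatePoints_eq_jet a r p q).trans
    (boundaryPoints_eq hr_pos hM hMeq hY hZ hYa hZa 0 2)
  have hfocal := (focalPoints_eq_jet a r p q).trans
    (boundaryPoints_eq hr_pos hM hMeq hY hZ hYa hZa 1 3)
  have part1 : ∀ η : ℝ, IsSystemsConjugatePoint a r p q η → FormPositive a r q →
      ∃ μ : ℝ, IsSystemsFocalPoint a r p q μ ∧ a < μ ∧ μ < η := by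
    intro η hη hpos
    rw [IsSystemsConjugatePoint, hconj] at hη
    obtain ⟨haη, hη0⟩ := hη.1
    obtain ⟨φ, ζ, hφa, hζa, hφ, hζ⟩ := exists_sturmLiouville_solution hR hQ hR0 a 1 0
    have hsign : ∀ t, a ≤ t → 0 < φ t ∧ 0 ≤ ζ t := fun t ht =>
      hpos.pos_and_nonneg hR hQ hR0 hRr hQq hφ hζ hφa hζa ht
    have hcont : ContinuousOn (fun t => Y t 1 * Z t 3 - Z t 1 * Y t 3) (Ici a) := fun t ht =>
      (hminor.d13 t ht).continuousAt.continuousWithinAt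
    obtain ⟨τ, hτ, hτpos⟩ := hminor.exists_m13_pos
    obtain ⟨b, hb, hb0⟩ : ∃ b ∈ Ioo a η, Y b 1 * Z b 3 - Z b 1 * Y b 3 = 0 := by
      by_contra! hne
      refine (hminor.m02_pos (fun t _ => hR0 t) haη (fun t _ => hφ t) (fun t _ => hζ t)
        (fun t ht => (hsign t ht.1).1) (fun t ht => (hsign t ht.1).2) fun t ht => ?_).ne' hη0
      by_contra! hle
      obtain ⟨s, hs, hs0⟩ := intermediate_value_Icc' ht.1.le
        (hcont.mono Icc_subset_Ici_self) ⟨hle, (hτpos a ⟨le_rfl, hτ.le⟩).le⟩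
      rcases hs.1.eq_or_lt with rfl | has
      · exact (hτpos a ⟨le_rfl, hτ.le⟩).ne' hs0
      · exact hne s ⟨has, hs.2.trans_lt ht.2⟩ hs0
    obtain ⟨μ, hμ⟩ := exists_isLeast_zero hcont hτ
      (fun t ht => (hτpos t ⟨ht.1.le, ht.2⟩).ne') hb.1 hb0
    refine ⟨μ, ?_, hμ.1.1, (hμ.2 ⟨hb.1, hb0⟩).trans_lt hb.2⟩
    rw [IsSystemsFocalPoint, hfocal]
    exact hμ
  refine ⟨part1, fun μ hμ hlim => ?_⟩
  obtain ⟨haμ, hμ0⟩ : a < μ ∧ Y μ 1 * Z μ 3 - Z μ 1 * Y μ 3 = 0 := by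
    have := hμ.1
    rw [hfocal] at this
    exact this
  -- Existence of `η` must not use (P), so here `ζ a = 1` rather than `0`: positivity is needed only
  -- near `a`.
  obtain ⟨φ, ζ, hφa, hζa, hφ, hζ⟩ := exists_sturmLiouville_solution hR hQ hR0 a 1 1
  obtain ⟨τ, hτ, hτpos⟩ := hminor.exists_m02_pos (fun t _ => hR0 t) (fun t _ => hφ t)
    (fun t _ => hζ t) (by simp [hφa]) (by simp [hζa])
  have hlimQ : Tendsto (fun x => ∫ t in a..x, Q t) atTop atBot := by
    refine hlim.congr' ?_
    filter_upwards [eventually_ge_atTop a] with x hx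
    refine intervalIntegral.integral_congr fun t ht => ?_
    rw [uIcc_of_le hx] at ht
    exact (hQq ht.1).symm
  obtain ⟨b, hab, hb0⟩ := hminor.exists_m02_eq_zero (fun t _ => hR0 t) (fun t _ => hP0 t) hQ hτ
    (hτpos τ ⟨hτ, le_rfl⟩) haμ hμ0 hlimQ
  obtain ⟨η, hη⟩ := exists_isLeast_zero
    (fun t ht => (hminor.d02 t ht).continuousAt.continuousWithinAt) hτ
    (fun t ht => (hτpos t ht).ne') hab hb0
  have hη' : IsSystemsConjugatePoint a r p q η := by
    rw [IsSystemsConjugatePoint, hconj]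
    exact hη
  refine ⟨η, hη', fun hpos => ?_⟩
  -- Part 1 yields a focal point below `η`, and `μ` is the least one.
  obtain ⟨μ', hμ', haμ', hμη⟩ := part1 η hη' hpos
  exact ⟨haμ, (hμ.2 hμ'.1).trans_lt hμη⟩
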